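/- For $n\ge 1$ and graphs $G,G'$ on $[n]=\{1,\dots,n\}$, let $G\oplus G'$ be the graph on $[n]$ whose edge set is the symmetric difference of the edge sets of $G$ and $G'$. Let $M_{Hp}(n)$ denote the maximum size of a family of graphs on $[n]$ such that $G\oplus G'$ contains a Hamiltonian path for any two distinct members $G,G'$ of the family. A perfect $1$-factorization of a graph is a partition of its edge set into perfect matchings such that the union of any two of them is a Hamiltonian cycle. **Theorem.** 1. Let $n\ge 1$ be such that the complete graph $K_{n+1}$ has a perfect $1$-factorization. Then $M_{Hp}(n)=2^{n-1}$. Moreover, for every perfect $1$-factorization $\mathcal M$ of $K_{n+1}$ and every vertex $v$ of $K_{n+1}$, the graphs on the $n$ vertices other than $v$ that arise by taking the union of an even number (possibly zero) of the matchings in $\mathcal M$ and deleting $v$ form a family of exactly $2^{n-1}$ graphs in which the symmetric difference of any two distinct members contains a Hamiltonian path. 2. For every odd prime $p$, $M_{Hp}(p)=2^{p-1}$ and $M_{Hp}(2p-1)=2^{2p-2}$. 3. In particular, $M_{Hp}(n)=2^{n-1}$ for infinitely many $n$. -/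

import Mathlib

open scoped symmDiff

/-- A family `𝒢` of graphs on a common vertex set `V` is good for the property `P` if the symmetric
difference of any two distinct members has the property `P`. The symmetric difference `G ∆ G'` is
the graph on `V` whose edge set is the symmetric difference of the edge sets
(see `edgeSet_symmDiff_graph`). -/
def IsGoodFamily {V : Type*} (P : SimpleGraph V → Prop) (𝒢 : Set (SimpleGraph V)) : Prop :=
  𝒢.Pairwise fun G G' => P (G ∆ G')

theorem edgeSet_symmDiff_graph {V : Type*} (G G' : SimpleGraph V) :
    (G ∆ G').edgeSet = (G.edgeSet \ G'.edgeSet) ∪ (G'.edgeSet \ G.edgeSet) := by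
  simp [symmDiff_def]

/-- The graph contains a Hamiltonian path. -/
def HasHamiltonianPath {V : Type*} [DecidableEq V] (G : SimpleGraph V) : Prop :=
  ∃ (a b : V) (p : G.Walk a b), p.IsHamiltonian

/-- The maximum size of a family of graphs on the vertex set `V` that is good for `P`
(a genuine maximum over a finite vertex set, see `isGreatest_maxGoodSize`). -/
noncomputable def maxGoodSize {V : Type*} (P : SimpleGraph V → Prop) : ℕ :=
  sSup {k | ∃ 𝒢 : Set (SimpleGraph V), IsGoodFamily P 𝒢 ∧ 𝒢.ncard = k}

theorem isGreatest_maxGoodSize {V : Type*} [Finite V] (P : SimpleGraph V → Prop) :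
    IsGreatest {k | ∃ 𝒢 : Set (SimpleGraph V), IsGoodFamily P 𝒢 ∧ 𝒢.ncard = k}
      (maxGoodSize P) := by
  have hne : {k | ∃ 𝒢 : Set (SimpleGraph V), IsGoodFamily P 𝒢 ∧ 𝒢.ncard = k}.Nonempty :=
    ⟨0, ∅, Set.pairwise_empty _, Set.ncard_empty _⟩
  have hbd : BddAbove {k | ∃ 𝒢 : Set (SimpleGraph V), IsGoodFamily P 𝒢 ∧ 𝒢.ncard = k} := by
    refine ⟨Nat.card (SimpleGraph V), ?_⟩
    rintro k ⟨𝒢, -, rfl⟩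
    exact Set.ncard_le_card 𝒢
  exact ⟨Nat.sSup_mem hne hbd, fun k hk => le_csSup hbd hk⟩

/-- A perfect 1-factorization of `G`: a partition of the edge set of `G` into perfect matchings
such that the union of any two of them is a Hamiltonian cycle. -/
structure IsPerfectOneFactorization {V : Type*} [DecidableEq V] (G : SimpleGraph V)
    (ℳ : Set G.Subgraph) : Prop where
  isPerfectMatching : ∀ M ∈ ℳ, M.IsPerfectMatching
  existsUnique_mem : ∀ e ∈ G.edgeSet, ∃! M, M ∈ ℳ ∧ e ∈ M.edgeSet
  union_isHamiltonianCycle : ∀ M ∈ ℳ, ∀ N ∈ ℳ, M ≠ N →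
    ∃ (a : V) (c : G.Walk a a), c.IsHamiltonianCycle ∧ c.toSubgraph = M ⊔ N

/-- The graphs on `Fin n` obtained from a set `ℳ` of subgraphs of the complete graph on
`Fin (n + 1)` by taking the union of an even number of members of `ℳ` (possibly none) and deleting
the vertex `v`; the remaining vertices are relabelled by `Fin n` in increasing order. -/
def evenUnionsDeleting {n : ℕ} (ℳ : Set (⊤ : SimpleGraph (Fin (n + 1))).Subgraph)
    (v : Fin (n + 1)) : Set (SimpleGraph (Fin n)) :=
  {H | ∃ S : Finset (⊤ : SimpleGraph (Fin (n + 1))).Subgraph, (∀ M ∈ S, M ∈ ℳ) ∧ Even S.card ∧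
    H = (⨆ M ∈ S, M.spanningCoe).comap v.succAbove}

/-! ### Hamiltonian paths from sequences of vertices -/

/-! Upper bound: fix a vertex `v`. If two members had the same neighbours at `v`, then `v` would be
isolated in their symmetric difference, which is impossible for a Hamiltonian path on at least two
vertices. So members inject into subsets of the other `n - 1` vertices (`IsGoodFamily.ncard_le`).

Lower bound: it suffices to have `n` edge-disjoint graphs such that any two together contain a
Hamiltonian path. Two distinct even subsets of the index set differ in at least two indices, so the
symmetric difference of the two unions contains two of the graphs (`exists_sup_le_symmDiff_iSup`),
and there are `2 ^ (n - 1)` even subsets. A perfect 1-factorization of the complete graph on `n + 1`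
vertices has `n` matchings, and deleting `v` turns each Hamiltonian cycle into a Hamiltonian path.

For `n = p` the graphs are the reflections `x + y = 2 i` of `ZMod p`. For `n = 2 p - 1` they come
from two copies of `ZMod p`: `p` doubled reflections and `p - 1` nonzero shifts, with one vertex
deleted. The Hamiltonian paths and cycles are explicit sequences. -/

theorem exists_walk_support_eq_map_range {V : Type*} {G : SimpleGraph V} (f : ℕ → V) (k : ℕ)
    (hadj : ∀ j < k, G.Adj (f j) (f (j + 1))) :
    ∃ p : G.Walk (f 0) (f k), p.support = (List.range (k + 1)).map f := by
  induction k with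
  | zero => exact ⟨SimpleGraph.Walk.nil, by simp⟩
  | succ k ih =>
    obtain ⟨p, hp⟩ := ih fun j hj => hadj j (by omega)
    refine ⟨p.concat (hadj k (by omega)), ?_⟩
    rw [SimpleGraph.Walk.support_concat, hp, List.range_succ (n := k + 1)]
    simp

theorem hasHamiltonianPath_of_seq {V : Type*} [DecidableEq V] [Fintype V] {G : SimpleGraph V}
    (f : ℕ → V) (hpos : 0 < Fintype.card V)
    (hadj : ∀ j, j + 1 < Fintype.card V → G.Adj (f j) (f (j + 1)))
    (hinj : Set.InjOn f (Set.Iio (Fintype.card V))) : HasHamiltonianPath G := by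
  obtain ⟨p, hp⟩ := exists_walk_support_eq_map_range f (Fintype.card V - 1)
    (fun j hj => hadj j (by omega))
  rw [Nat.sub_add_cancel hpos] at hp
  refine ⟨_, _, p, SimpleGraph.Walk.isHamiltonian_iff_isPath_and_length_eq.2 ⟨?_, ?_⟩⟩
  · refine SimpleGraph.Walk.IsPath.mk' ?_
    rw [hp]
    refine List.Nodup.map_on (fun x hx y hy h => ?_) List.nodup_range
    exact hinj (List.mem_range.1 hx) (List.mem_range.1 hy) h
  · have := congrArg List.length hp
    simp at this
    omega

/-- A Hamiltonian cycle, given as a cyclic sequence of vertices, becomes a Hamiltonian path when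
a vertex is deleted. -/
theorem hasHamiltonianPath_comap_of_cyclic_seq {U W : Type*} [DecidableEq U] [Fintype U]
    [Fintype W] {G : SimpleGraph W} (e : U → W) (v : W)
    (hrange : ∀ w, w ≠ v → ∃ u, e u = w) (hcard : Fintype.card W = Fintype.card U + 1)
    (hpos : 0 < Fintype.card U) (f : ℕ → W)
    (hadj : ∀ j, j + 1 < Fintype.card W → G.Adj (f j) (f (j + 1)))
    (hclose : G.Adj (f (Fintype.card W - 1)) (f 0))
    (hinj : Set.InjOn f (Set.Iio (Fintype.card W))) : HasHamiltonianPath (G.comap e) := by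
  set L := Fintype.card W with hL
  have hLpos : 0 < L := by omega
  have hbij : Function.Bijective fun k : Fin L => f k := by
    rw [Fintype.bijective_iff_injective_and_card]
    exact ⟨fun a b h => Fin.ext (hinj a.2 b.2 h), by simp [hL]⟩
  obtain ⟨k, rfl⟩ := hbij.2 v
  have hmod : ∀ j, G.Adj (f (j % L)) (f ((j + 1) % L)) := by
    intro j
    have h := Nat.mod_lt j hLpos
    by_cases hj : j % L + 1 < L
    · have : (j + 1) % L = j % L + 1 := by
        rw [Nat.add_mod, Nat.mod_eq_of_lt (show 1 < L by omega), Nat.mod_eq_of_lt hj]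
      rw [this]
      exact hadj _ hj
    · have h1 : j % L = L - 1 := by omega
      have : (j + 1) % L = 0 := by
        rw [← Nat.mod_add_mod, h1, Nat.sub_add_cancel hLpos, Nat.mod_self]
      rw [this, h1]
      exact hclose
  have hinj' : ∀ i j, i < L → j < L → f ((k + i) % L) = f ((k + j) % L) → i = j := by
    intro i j hi hj h
    have h2 : (k + i) % L = (k + j) % L := hinj (Nat.mod_lt _ hLpos) (Nat.mod_lt _ hLpos) h
    have h3 : i ≡ j [MOD L] := Nat.ModEq.add_left_cancel' (k : ℕ) h2
    exact Nat.ModEq.eq_of_lt_of_lt h3 hi hj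
  -- The offset `1 + j` starts the path just after the deleted vertex `f k` and stops before the
  -- cycle returns to it.
  have hne : ∀ j, j < Fintype.card U → f ((k + (1 + j)) % L) ≠ f k := by
    intro j hj h
    have := hinj' (1 + j) 0 (by omega) (by omega) (by simpa [Nat.mod_eq_of_lt k.2] using h)
    omega
  -- The bound sits inside the existential so that the chosen `g` is total on `ℕ`; its values beyond
  -- the bound are irrelevant.
  have hex : ∀ j, ∃ u, j < Fintype.card U → e u = f ((k + (1 + j)) % L) := by
    intro j
    by_cases hj : j < Fintype.card U
    · obtain ⟨u, hu⟩ := hrange _ (hne j hj)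
      exact ⟨u, fun _ => hu⟩
    · exact ⟨(Fintype.card_pos_iff.1 hpos).some, fun h => absurd h hj⟩
  choose g hg using hex
  refine hasHamiltonianPath_of_seq g hpos (fun j hj => ?_) (fun i hi j hj h => ?_)
  · rw [SimpleGraph.comap_adj, hg j (by omega), hg (j + 1) hj]
    exact hmod _
  · have hi' : i < Fintype.card U := hi
    have hj' : j < Fintype.card U := hj
    have h' := congrArg e h
    rw [hg i hi', hg j hj'] at h'
    have := hinj' _ _ (by omega) (by omega) h'
    omega

theorem HasHamiltonianPath.mono {V : Type*} [DecidableEq V] {G H : SimpleGraph V} (hGH : G ≤ H)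
    (hG : HasHamiltonianPath G) : HasHamiltonianPath H := by
  obtain ⟨a, b, p, hp⟩ := hG
  refine ⟨a, b, p.mapLe hGH, fun v => ?_⟩
  have := hp v
  simpa using this

theorem HasHamiltonianPath.map_equiv {V W : Type*} [DecidableEq V] [DecidableEq W] (e : V ≃ W)
    {G : SimpleGraph W} (hG : HasHamiltonianPath G) : HasHamiltonianPath (G.comap e) := by
  obtain ⟨a, b, p, hp⟩ := hG
  let φ : G →g G.comap e := ⟨e.symm, by simp⟩
  exact ⟨_, _, p.map φ, hp.map φ e.symm.bijective⟩

theorem HasHamiltonianPath.exists_adj {V : Type*} [DecidableEq V] [Nontrivial V]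
    {G : SimpleGraph V} (hG : HasHamiltonianPath G) (v : V) : ∃ w, G.Adj v w := by
  obtain ⟨a, b, p, hp⟩ := hG
  have hc : G.Connected := by
    rw [SimpleGraph.connected_iff_exists_forall_reachable]
    exact ⟨a, fun w => (p.takeUntil w (hp.mem_support w)).reachable⟩
  exact hc.preconnected.exists_adj_of_nontrivial v

/-! ### The upper bound -/

theorem IsGoodFamily.ncard_le {V : Type*} [DecidableEq V] [Fintype V] [Nonempty V]
    {𝒢 : Set (SimpleGraph V)} (h𝒢 : IsGoodFamily HasHamiltonianPath 𝒢) :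
    𝒢.ncard ≤ 2 ^ (Fintype.card V - 1) := by
  classical
  obtain ⟨v⟩ := ‹Nonempty V›
  cases subsingleton_or_nontrivial V with
  -- On one vertex the trivial path is Hamiltonian without giving `v` a neighbour, but there is only
  -- one graph.
  | inl h =>
    exact (Set.ncard_le_one_iff_subsingleton.2 Set.subsingleton_of_subsingleton).trans
      Nat.one_le_two_pow
  | inr h =>
    have hmaps : ∀ G ∈ 𝒢, (Finset.univ.filter fun w => G.Adj v w) ∈
        ((Finset.univ.erase v).powerset : Set (Finset V)) := by
      intro G _
      simp only [Finset.mem_coe, Finset.mem_powerset]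
      intro w hw
      simp only [Finset.mem_filter, Finset.mem_univ, true_and] at hw
      simp [hw.ne']
    have hinj : Set.InjOn (fun G : SimpleGraph V => Finset.univ.filter fun w => G.Adj v w) 𝒢 := by
      intro G hG H hH hGH
      by_contra hne
      obtain ⟨w, hw⟩ := (h𝒢 hG hH hne).exists_adj v
      have := congrArg (w ∈ ·) hGH
      simp only [Finset.mem_filter, Finset.mem_univ, true_and, eq_iff_iff] at this
      simp only [symmDiff_def, SimpleGraph.sup_adj, SimpleGraph.sdiff_adj] at hw
      tauto
    have := Set.ncard_le_ncard_of_injOn _ hmaps hinj (Set.toFinite _)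
    rwa [Set.ncard_coe_finset, Finset.card_powerset, Finset.card_erase_of_mem (Finset.mem_univ v),
      Finset.card_univ] at this

theorem maxGoodSize_eq_of_exists {V : Type*} [DecidableEq V] [Fintype V] [Nonempty V]
    (h : ∃ 𝒢 : Set (SimpleGraph V), IsGoodFamily HasHamiltonianPath 𝒢 ∧
      𝒢.ncard = 2 ^ (Fintype.card V - 1)) :
    maxGoodSize (HasHamiltonianPath (V := V)) = 2 ^ (Fintype.card V - 1) := by
  refine le_antisymm ?_ ((isGreatest_maxGoodSize _).2 h)
  obtain ⟨𝒢, h𝒢, hcard⟩ := (isGreatest_maxGoodSize (HasHamiltonianPath (V := V))).1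
  exact hcard ▸ h𝒢.ncard_le

/-! ### Even unions of disjoint graphs -/

/-- For a fixed `a ∈ I`, parity decides whether `a` belongs to an even set, so erasing `a` is a
bijection onto the subsets of `I.erase a`. -/
theorem Finset.card_powerset_filter_even_card {ι : Type*} [DecidableEq ι] {I : Finset ι}
    (hI : I.Nonempty) : (I.powerset.filter fun S => Even S.card).card = 2 ^ (I.card - 1) := by
  obtain ⟨a, ha⟩ := hI
  rw [← Finset.card_erase_of_mem ha, ← Finset.card_powerset]
  refine Finset.card_bij' (fun S _ => S.erase a)
    (fun T _ => if Even T.card then T else insert a T) ?_ ?_ ?_ ?_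
  · intro S hS
    simp only [Finset.mem_filter, Finset.mem_powerset] at hS ⊢
    exact Finset.erase_subset_erase a hS.1
  · intro T hT
    simp only [Finset.mem_filter, Finset.mem_powerset] at hT ⊢
    have haT : a ∉ T := fun h => by simpa using hT h
    have hTI : T ⊆ I := hT.trans (Finset.erase_subset _ _)
    split_ifs with h
    · exact ⟨hTI, h⟩
    · refine ⟨Finset.insert_subset ha hTI, ?_⟩
      rw [Finset.card_insert_of_notMem haT]
      exact (Nat.not_even_iff_odd.1 h).add_one
  · intro S hS
    simp only [Finset.mem_filter, Finset.mem_powerset] at hS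
    by_cases haS : a ∈ S
    · have : ¬ Even (S.erase a).card := by
        intro h
        have h1 := Finset.card_erase_add_one haS
        have h2 := hS.2
        rw [← h1] at h2
        exact (Nat.even_add_one.1 h2) h
      simp [this, Finset.insert_erase haS]
    · simp [Finset.erase_eq_of_notMem haS, hS.2]
  · intro T hT
    simp only [Finset.mem_powerset] at hT
    have haT : a ∉ T := fun h => by simpa using hT h
    split_ifs with h
    · exact Finset.erase_eq_of_notMem haT
    · exact Finset.erase_insert haT

/-- The unions of an even number of the graphs `F i`, `i ∈ I`. -/
def evenUnions {ι V : Type*} (F : ι → SimpleGraph V) (I : Finset ι) : Set (SimpleGraph V) :=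
  {H | ∃ S ⊆ I, Even S.card ∧ H = ⨆ i ∈ S, F i}

/-- `S ∆ T` is nonempty of even size, hence contains two indices. By disjointness, a graph indexed
by only one of `S`, `T` has no edge in the other union. -/
theorem exists_sup_le_symmDiff_iSup {ι V : Type*} {F : ι → SimpleGraph V} {I S T : Finset ι}
    (hdisj : ∀ i ∈ I, ∀ j ∈ I, i ≠ j → Disjoint (F i) (F j)) (hS : S ⊆ I) (hT : T ⊆ I)
    (hSe : Even S.card) (hTe : Even T.card) (hne : S ≠ T) :
    ∃ i ∈ I, ∃ j ∈ I, i ≠ j ∧ F i ⊔ F j ≤ (⨆ i ∈ S, F i) ∆ (⨆ i ∈ T, F i) := by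
  classical
  have hsub : S ∆ T ⊆ I := by
    intro i hi
    rcases Finset.mem_symmDiff.1 hi with h | h
    exacts [hS h.1, hT h.1]
  have hcard : 1 < (S ∆ T).card := by
    have hpos : 0 < (S ∆ T).card := by
      rw [Finset.card_pos, Finset.nonempty_iff_ne_empty]
      exact fun h => hne (symmDiff_eq_bot.1 h)
    have h1 := Finset.card_sdiff_add_card_inter S T
    have h2 := Finset.card_sdiff_add_card_inter T S
    have h3 : (S ∆ T).card = (S \ T).card + (T \ S).card := by
      rw [symmDiff_def, Finset.sup_eq_union, Finset.card_union_of_disjoint disjoint_sdiff_sdiff]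
    rw [Finset.inter_comm] at h2
    obtain ⟨a, ha⟩ := hSe
    obtain ⟨b, hb⟩ := hTe
    omega
  have hle : ∀ i ∈ S ∆ T, F i ≤ (⨆ i ∈ S, F i) ∆ (⨆ i ∈ T, F i) := by
    have key : ∀ S' T' : Finset ι, S' ⊆ I → T' ⊆ I → ∀ i ∈ S', i ∉ T' →
        F i ≤ (⨆ i ∈ S', F i) \ (⨆ i ∈ T', F i) := by
      intro S' T' hS' hT' i hi hi'
      refine le_sdiff.2 ⟨le_iSup₂_of_le i hi le_rfl, ?_⟩
      rw [SimpleGraph.disjoint_left]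
      intro x y hxy h
      simp only [SimpleGraph.iSup_adj] at h
      obtain ⟨j, hj, h⟩ := h
      exact SimpleGraph.disjoint_left.1 (hdisj i (hS' hi) j (hT' hj) fun h => hi' (h ▸ hj)) x y hxy h
    intro i hi
    rcases Finset.mem_symmDiff.1 hi with h | h
    · exact (key S T hS hT i h.1 h.2).trans le_sup_left
    · exact (key T S hT hS i h.1 h.2).trans le_sup_right
  obtain ⟨i, hi, j, hj, hij⟩ := Finset.one_lt_card.1 hcard
  exact ⟨i, hsub hi, j, hsub hj, hij, sup_le (hle i hi) (hle j hj)⟩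

theorem isGoodFamily_evenUnions {ι V : Type*} [DecidableEq V]
    {F : ι → SimpleGraph V} {I : Finset ι}
    (hdisj : ∀ i ∈ I, ∀ j ∈ I, i ≠ j → Disjoint (F i) (F j))
    (hham : ∀ i ∈ I, ∀ j ∈ I, i ≠ j → HasHamiltonianPath (F i ⊔ F j)) :
    IsGoodFamily HasHamiltonianPath (evenUnions F I) := by
  rintro _ ⟨S, hS, hSe, rfl⟩ _ ⟨T, hT, hTe, rfl⟩ hne
  obtain ⟨i, hi, j, hj, hij, hle⟩ := exists_sup_le_symmDiff_iSup hdisj hS hT hSe hTe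
    (fun h => hne (by rw [h]))
  exact (hham i hi j hj hij).mono hle

theorem ncard_evenUnions {ι V : Type*} [DecidableEq V] [Fintype V]
    {F : ι → SimpleGraph V} {I : Finset ι} (hne : I.Nonempty) (hcard : I.card = Fintype.card V)
    (hdisj : ∀ i ∈ I, ∀ j ∈ I, i ≠ j → Disjoint (F i) (F j))
    (hham : ∀ i ∈ I, ∀ j ∈ I, i ≠ j → HasHamiltonianPath (F i ⊔ F j)) :
    (evenUnions F I).ncard = 2 ^ (Fintype.card V - 1) := by
  classical
  rw [← hcard, ← Finset.card_powerset_filter_even_card hne, ← Set.ncard_coe_finset]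
  have himage : evenUnions F I = (fun S : Finset ι => ⨆ i ∈ S, F i) ''
      (I.powerset.filter fun S => Even S.card : Finset (Finset ι)) := by
    ext H
    simp only [evenUnions, Set.mem_image, Finset.coe_filter, Finset.mem_powerset]
    constructor
    · rintro ⟨S, hS, hSe, rfl⟩
      exact ⟨S, ⟨hS, hSe⟩, rfl⟩
    · rintro ⟨S, ⟨hS, hSe⟩, rfl⟩
      exact ⟨S, hS, hSe, rfl⟩
  rw [himage]
  refine Set.InjOn.ncard_image fun S hS T hT h => ?_
  simp only [Finset.coe_filter, Finset.mem_powerset, Set.mem_ofPred_eq] at hS hT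
  by_contra hST
  obtain ⟨i, hi, j, hj, hij, hle⟩ :=
    exists_sup_le_symmDiff_iSup hdisj hS.1 hT.1 hS.2 hT.2 hST
  -- Equal unions would make the symmetric difference empty, yet it contains a Hamiltonian path on
  -- at least two vertices.
  have hnt : Nontrivial V := by
    rw [← Fintype.one_lt_card_iff_nontrivial, ← hcard]
    exact Finset.one_lt_card.2 ⟨i, hi, j, hj, hij⟩
  obtain ⟨v⟩ := hnt.to_nonempty
  obtain ⟨w, hw⟩ := ((hham i hi j hj hij).mono hle).exists_adj v
  rw [show (⨆ i ∈ S, F i) = ⨆ i ∈ T, F i from h, symmDiff_self] at hw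
  exact hw

theorem maxGoodSize_eq_of_disjoint {ι V : Type*} [DecidableEq V] [Fintype V] [Fintype ι]
    [Nonempty ι] {F : ι → SimpleGraph V} (hcard : Fintype.card ι = Fintype.card V)
    (hdisj : ∀ i j, i ≠ j → Disjoint (F i) (F j))
    (hham : ∀ i j, i ≠ j → HasHamiltonianPath (F i ⊔ F j)) :
    maxGoodSize (HasHamiltonianPath (V := V)) = 2 ^ (Fintype.card V - 1) := by
  have : Nonempty V := by
    rw [← Fintype.card_pos_iff, ← hcard]
    exact Fintype.card_pos
  exact maxGoodSize_eq_of_exists ⟨evenUnions F Finset.univ,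
    isGoodFamily_evenUnions (fun i _ j _ => hdisj i j) fun i _ j _ => hham i j,
    ncard_evenUnions Finset.univ_nonempty hcard (fun i _ j _ => hdisj i j) fun i _ j _ => hham i j⟩

/-! ### Perfect 1-factorizations of complete graphs -/

theorem disjoint_comap {U W : Type*} {G H : SimpleGraph W} (e : U → W) (h : Disjoint G H) :
    Disjoint (G.comap e) (H.comap e) :=
  SimpleGraph.disjoint_left.2 fun x y hxy => SimpleGraph.disjoint_left.1 h (e x) (e y) hxy

namespace IsPerfectOneFactorization

variable {n : ℕ} {ℳ : Set (⊤ : SimpleGraph (Fin (n + 1))).Subgraph}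

theorem disjoint_spanningCoe {V : Type*} [DecidableEq V] {G : SimpleGraph V} {ℳ : Set G.Subgraph}
    (h : IsPerfectOneFactorization G ℳ) {M N : G.Subgraph} (hM : M ∈ ℳ) (hN : N ∈ ℳ)
    (hne : M ≠ N) : Disjoint M.spanningCoe N.spanningCoe :=
  SimpleGraph.disjoint_left.2 fun x y hx hy => hne <|
    (h.existsUnique_mem s(x, y) (M.adj_sub hx)).unique ⟨hM, hx⟩ ⟨hN, hy⟩

/-- Each matching covers the vertex `0` by exactly one edge, so the matchings correspond to the `n`
edges at `0`. -/
theorem ncard_eq (h : IsPerfectOneFactorization (⊤ : SimpleGraph (Fin (n + 1))) ℳ) :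
    ℳ.ncard = n := by
  have hadj : ∀ w : Fin n, (⊤ : SimpleGraph (Fin (n + 1))).Adj 0 w.succ := fun w => by
    simpa using (Fin.succ_ne_zero w).symm
  choose φ hφ _ using fun w : Fin n => h.existsUnique_mem s(0, w.succ) (hadj w)
  have hinj : Function.Injective φ := by
    intro a b hab
    have h1 : (φ a).Adj 0 a.succ := (hφ a).2
    have h2 : (φ a).Adj 0 b.succ := hab ▸ (hφ b).2
    have hm := SimpleGraph.Subgraph.isPerfectMatching_iff.1 (h.isPerfectMatching _ (hφ a).1) 0
    exact Fin.succ_injective _ (hm.unique h1 h2)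
  have hrange : ℳ = Set.range φ := by
    ext M
    constructor
    · intro hM
      obtain ⟨w, hw, -⟩ := SimpleGraph.Subgraph.isPerfectMatching_iff.1 (h.isPerfectMatching _ hM) 0
      have hw0 : w ≠ 0 := (M.adj_sub hw).ne'
      obtain ⟨u, rfl⟩ := Fin.exists_succ_eq.2 hw0
      exact ⟨u, (h.existsUnique_mem s(0, u.succ) (hadj u)).unique (hφ u) ⟨hM, hw⟩⟩
    · rintro ⟨w, rfl⟩
      exact (hφ w).1
  rw [hrange, ← Set.image_univ, Set.InjOn.ncard_image hinj.injOn, Set.ncard_univ, Nat.card_fin]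

theorem hasHamiltonianPath_comap_sup
    (h : IsPerfectOneFactorization (⊤ : SimpleGraph (Fin (n + 1))) ℳ) (hn : 1 ≤ n)
    (v : Fin (n + 1)) {M N : (⊤ : SimpleGraph (Fin (n + 1))).Subgraph} (hM : M ∈ ℳ) (hN : N ∈ ℳ)
    (hne : M ≠ N) :
    HasHamiltonianPath (M.spanningCoe.comap v.succAbove ⊔ N.spanningCoe.comap v.succAbove) := by
  obtain ⟨a, c, hc, hcs⟩ := h.union_isHamiltonianCycle M hM N hN hne
  have hlen : c.length = n + 1 := by simpa using hc.length_eq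
  have hadj : ∀ j, j < n + 1 →
      (M.spanningCoe ⊔ N.spanningCoe).Adj (c.getVert j) (c.getVert (j + 1)) := by
    intro j hj
    have := c.toSubgraph_adj_getVert (i := j) (by omega)
    rw [hcs] at this
    simpa using this
  change HasHamiltonianPath ((M.spanningCoe ⊔ N.spanningCoe).comap v.succAbove)
  refine hasHamiltonianPath_comap_of_cyclic_seq v.succAbove v
    (fun w hw => Fin.exists_succAbove_eq hw) (by simp) (by rw [Fintype.card_fin]; omega) c.getVert ?_ ?_ ?_
  · intro j hj
    rw [Fintype.card_fin] at hj
    exact hadj j (by omega)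
  · have := hadj n (by omega)
    have hend : c.getVert (n + 1) = c.getVert 0 := by
      rw [c.getVert_zero, c.getVert_of_length_le (by omega)]
    rw [hend] at this
    simpa using this
  · intro i hi j hj hij
    simp only [Fintype.card_fin, Set.mem_Iio] at hi hj
    exact hc.isCycle.getVert_injOn' (by rw [Set.mem_ofPred_eq]; omega)
      (by rw [Set.mem_ofPred_eq]; omega) hij

end IsPerfectOneFactorization

theorem evenUnionsDeleting_eq_evenUnions {n : ℕ}
    {ℳ : Set (⊤ : SimpleGraph (Fin (n + 1))).Subgraph} (hfin : ℳ.Finite) (v : Fin (n + 1)) :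
    evenUnionsDeleting ℳ v =
      evenUnions (fun M => M.spanningCoe.comap v.succAbove) hfin.toFinset := by
  have hcomap : ∀ S : Finset (⊤ : SimpleGraph (Fin (n + 1))).Subgraph,
      (⨆ M ∈ S, M.spanningCoe).comap v.succAbove =
        ⨆ M ∈ S, M.spanningCoe.comap v.succAbove := by
    intro S
    ext x y
    simp
  ext H
  simp only [evenUnionsDeleting, evenUnions, Set.mem_ofPred_eq, hcomap]
  constructor
  · rintro ⟨S, hS, h⟩
    exact ⟨S, fun M hM => hfin.mem_toFinset.2 (hS M hM), h⟩
  · rintro ⟨S, hS, h⟩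
    exact ⟨S, fun M hM => hfin.mem_toFinset.1 (hS hM), h⟩

theorem IsPerfectOneFactorization.isGoodFamily_and_ncard {n : ℕ} (hn : 1 ≤ n)
    {ℳ : Set (⊤ : SimpleGraph (Fin (n + 1))).Subgraph}
    (h : IsPerfectOneFactorization (⊤ : SimpleGraph (Fin (n + 1))) ℳ) (v : Fin (n + 1)) :
    IsGoodFamily HasHamiltonianPath (evenUnionsDeleting ℳ v) ∧
      (evenUnionsDeleting ℳ v).ncard = 2 ^ (n - 1) := by
  -- An infinite set has `ncard` equal to `0`, so `1 ≤ n` gives finiteness.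
  have hfin : ℳ.Finite := Set.finite_of_ncard_pos (by rw [h.ncard_eq]; omega)
  have hcard : hfin.toFinset.card = n := by rw [← Set.ncard_eq_toFinset_card, h.ncard_eq]
  have hdisj : ∀ M ∈ hfin.toFinset, ∀ N ∈ hfin.toFinset, M ≠ N →
      Disjoint (M.spanningCoe.comap v.succAbove) (N.spanningCoe.comap v.succAbove) :=
    fun M hM N hN hne => disjoint_comap _
      (h.disjoint_spanningCoe (hfin.mem_toFinset.1 hM) (hfin.mem_toFinset.1 hN) hne)
  have hham := fun M (hM : M ∈ hfin.toFinset) N (hN : N ∈ hfin.toFinset) (hne : M ≠ N) =>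
    h.hasHamiltonianPath_comap_sup hn v (hfin.mem_toFinset.1 hM) (hfin.mem_toFinset.1 hN) hne
  rw [evenUnionsDeleting_eq_evenUnions hfin]
  refine ⟨isGoodFamily_evenUnions hdisj hham, ?_⟩
  have := ncard_evenUnions (Finset.card_pos.1 (by omega)) (by simpa using hcard) hdisj hham
  simpa using this

/-! ### Families of disjoint graphs from the field with `p` elements -/

theorem dvd_sub_of_intCast_mul_eq {p : ℕ} [Fact p.Prime] {d : ZMod p} (hd : d ≠ 0) {a b : ℤ}
    (h : (a : ZMod p) * d = b * d) : (p : ℤ) ∣ a - b := by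
  rw [← ZMod.intCast_zmod_eq_zero_iff_dvd, Int.cast_sub, sub_eq_zero]
  exact mul_right_cancel₀ hd h

/-- Reduces injectivity modulo `p` of the explicit sequences below to five integer cases; their
coefficients differ by at most `2 * p`. -/
theorem eq_of_dvd_of_abs_le_two_mul {p x : ℤ} (hp : 0 < p) (h : p ∣ x) (hx : |x| ≤ 2 * p) :
    x = 0 ∨ x = p ∨ x = -p ∨ x = 2 * p ∨ x = -(2 * p) := by
  obtain ⟨q, rfl⟩ := h
  rw [abs_mul, abs_of_pos hp, mul_comm 2 p] at hx
  have := abs_le.1 (le_of_mul_le_mul_left hx hp)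
  obtain ⟨h1, h2⟩ := this
  interval_cases q <;> simp [mul_comm]

section Odd

variable {p : ℕ} [Fact p.Prime]

/-- The zigzag sequence `0, 2, -2, 4, -4, …`. -/
def zigzag (k : ℕ) : ℤ := if k % 2 = 0 then -k else k + 1

/-- The sequence of vertices obtained from `i` by alternately reflecting in `j` and in `i`. -/
def reflSeq (i j : ZMod p) (k : ℕ) : ZMod p := i + zigzag k * (j - i)

theorem reflSeq_zero (i j : ZMod p) : reflSeq i j 0 = i := by simp [reflSeq, zigzag]

/-- The last coefficient is `1 - p`, which is `1` modulo `p`. Ending at `j` lets the doubled path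
cross between the copies. -/
theorem reflSeq_last (hodd : Odd p) (i j : ZMod p) : reflSeq i j (p - 1) = j := by
  obtain ⟨r, hr⟩ := hodd
  have h1 : zigzag (p - 1) = 1 - (p : ℤ) := by
    unfold zigzag
    rw [if_pos (by omega)]
    omega
  simp [reflSeq, h1]

/-- The coefficients are distinct even integers of absolute value less than `p`, so a difference
divisible by the odd `p` must vanish. -/
theorem reflSeq_injOn (hodd : Odd p) {i j : ZMod p} (hij : i ≠ j) :
    Set.InjOn (reflSeq i j) (Set.Iio p) := by
  intro k hk l hl h
  obtain ⟨r, hr⟩ := hodd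
  rw [Set.mem_Iio] at hk hl
  have hdvd := dvd_sub_of_intCast_mul_eq (sub_ne_zero.2 hij.symm) (add_left_cancel h)
  have hx : |zigzag k - zigzag l| ≤ 2 * (p : ℤ) := by
    rw [abs_le]
    unfold zigzag
    split_ifs <;> omega
  have := eq_of_dvd_of_abs_le_two_mul (by omega) hdvd hx
  unfold zigzag at this
  split_ifs at this <;> omega

theorem reflSeq_add_succ (i j : ZMod p) (k : ℕ) :
    reflSeq i j k + reflSeq i j (k + 1) = 2 * i ∨
      reflSeq i j k + reflSeq i j (k + 1) = 2 * j := by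
  have h : zigzag k + zigzag (k + 1) = 0 ∨ zigzag k + zigzag (k + 1) = 2 := by
    unfold zigzag
    split_ifs <;> omega
  have hs : reflSeq i j k + reflSeq i j (k + 1) =
      2 * i + ((zigzag k + zigzag (k + 1) : ℤ) : ZMod p) * (j - i) := by
    unfold reflSeq
    push_cast
    ring
  rcases h with h | h <;> rw [hs, h]
  · left; simp
  · right; push_cast; ring

/-- The matching `{x, y}`, `x + y = 2 i`, of the vertices other than `i`. -/
def reflGraph (i : ZMod p) : SimpleGraph (ZMod p) where
  Adj x y := x ≠ y ∧ x + y = 2 * i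
  symm := ⟨fun _ _ h => ⟨h.1.symm, by rw [add_comm]; exact h.2⟩⟩
  loopless := ⟨fun _ h => h.1 rfl⟩

theorem two_ne_zero_of_odd (hodd : Odd p) : (2 : ZMod p) ≠ 0 := by
  have h2 : ¬ p ∣ 2 := fun h => by
    have := (Nat.prime_dvd_prime_iff_eq Fact.out Nat.prime_two).1 h
    subst this
    exact absurd hodd (by decide)
  intro h
  exact h2 ((ZMod.natCast_eq_zero_iff 2 p).1 (by exact_mod_cast h))

theorem disjoint_reflGraph (hodd : Odd p) {i j : ZMod p} (hij : i ≠ j) :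
    Disjoint (reflGraph i) (reflGraph j) :=
  SimpleGraph.disjoint_left.2 fun _ _ hx hy =>
    hij (mul_left_cancel₀ (two_ne_zero_of_odd hodd) (hx.2.symm.trans hy.2))

theorem reflSeq_adj (hodd : Odd p) {i j : ZMod p} (hij : i ≠ j) {k : ℕ} (hk : k + 1 < p) :
    (reflGraph i ⊔ reflGraph j).Adj (reflSeq i j k) (reflSeq i j (k + 1)) := by
  have hne : reflSeq i j k ≠ reflSeq i j (k + 1) := fun h => by
    have := reflSeq_injOn hodd hij (Set.mem_Iio.2 (by omega)) (Set.mem_Iio.2 hk) h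
    omega
  rcases reflSeq_add_succ i j k with h | h
  · exact Or.inl ⟨hne, h⟩
  · exact Or.inr ⟨hne, h⟩

theorem hasHamiltonianPath_reflGraph_sup (hodd : Odd p) {i j : ZMod p} (hij : i ≠ j) :
    HasHamiltonianPath (reflGraph i ⊔ reflGraph j) := by
  refine hasHamiltonianPath_of_seq (reflSeq i j) Fintype.card_pos ?_ ?_
  · intro k hk
    rw [ZMod.card] at hk
    exact reflSeq_adj hodd hij hk
  · rw [ZMod.card]
    exact reflSeq_injOn hodd hij

/-! The perfect matchings of the complete graph on two copies of `ZMod p`. -/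

/-- The matching consisting of two copies of `reflGraph i` and an edge joining the copies
of `i`. -/
def doubleReflGraph (i : ZMod p) : SimpleGraph (ZMod p × Bool) where
  Adj x y := (x.2 = y.2 ∧ (reflGraph i).Adj x.1 y.1) ∨ (x.2 ≠ y.2 ∧ x.1 = i ∧ y.1 = i)
  symm := ⟨fun _ _ h => h.imp (fun h => ⟨h.1.symm, h.2.symm⟩) fun h => ⟨h.1.symm, h.2.2, h.2.1⟩⟩
  loopless := ⟨fun _ h => h.elim (fun h => h.2.ne rfl) fun h => h.1 rfl⟩

/-- The matching that joins `x` in the first copy to `x + d` in the second copy. -/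
def shiftGraph (d : ZMod p) : SimpleGraph (ZMod p × Bool) where
  Adj x y := (x.2 = false ∧ y.2 = true ∧ y.1 = x.1 + d) ∨
    (x.2 = true ∧ y.2 = false ∧ x.1 = y.1 + d)
  symm := ⟨fun _ _ h => h.symm.imp (fun h => ⟨h.2.1, h.1, h.2.2⟩) fun h => ⟨h.2.1, h.1, h.2.2⟩⟩
  loopless := ⟨fun _ h => by rcases h with ⟨h, h', -⟩ | ⟨h, h', -⟩ <;> simp [h] at h'⟩

theorem disjoint_doubleReflGraph (hodd : Odd p) {i j : ZMod p} (hij : i ≠ j) :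
    Disjoint (doubleReflGraph i) (doubleReflGraph j) := by
  refine SimpleGraph.disjoint_left.2 ?_
  rintro x y (hx | hx) (hy | hy)
  · exact SimpleGraph.disjoint_left.1 (disjoint_reflGraph hodd hij) _ _ hx.2 hy.2
  · exact hy.1 hx.1
  · exact hx.1 hy.1
  · exact hij (hx.2.1.symm.trans hy.2.1)

theorem disjoint_shiftGraph {d e : ZMod p} (hde : d ≠ e) :
    Disjoint (shiftGraph d) (shiftGraph e) := by
  refine SimpleGraph.disjoint_left.2 ?_
  rintro x y (hx | hx) (hy | hy)
  · exact hde (add_left_cancel (hx.2.2.symm.trans hy.2.2))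
  · simp_all
  · simp_all
  · exact hde (add_left_cancel (hx.2.2.symm.trans hy.2.2))

/-- The only edge of `doubleReflGraph i` between the copies is one of shift `0`. -/
theorem disjoint_doubleReflGraph_shiftGraph (i : ZMod p) {d : ZMod p} (hd : d ≠ 0) :
    Disjoint (doubleReflGraph i) (shiftGraph d) := by
  refine SimpleGraph.disjoint_left.2 ?_
  rintro x y (hx | hx) (hy | hy)
  · simp_all
  · simp_all
  · exact hd (by simpa [hx.2.1, hx.2.2] using hy.2.2)
  · exact hd (by simpa [hx.2.1, hx.2.2] using hy.2.2)

theorem card_zmod_prod_bool : Fintype.card (ZMod p × Bool) = 2 * p := by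
  rw [Fintype.card_prod, ZMod.card, Fintype.card_bool, mul_comm]

theorem hasHamiltonianPath_comap_of_cyclic_seq_two_mul {U : Type*} [DecidableEq U] [Fintype U]
    {e : U → ZMod p × Bool} {v : ZMod p × Bool} (hrange : ∀ w, w ≠ v → ∃ u, e u = w)
    (hcard : Fintype.card U + 1 = 2 * p) {G : SimpleGraph (ZMod p × Bool)}
    (f : ℕ → ZMod p × Bool) (hadj : ∀ j, j + 1 < 2 * p → G.Adj (f j) (f (j + 1)))
    (hclose : G.Adj (f (2 * p - 1)) (f 0)) (hinj : Set.InjOn f (Set.Iio (2 * p))) :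
    HasHamiltonianPath (G.comap e) := by
  have hp := (Fact.out : p.Prime).two_le
  have hpos : 0 < Fintype.card U := by omega
  rw [← card_zmod_prod_bool] at hadj hclose hinj hcard
  exact hasHamiltonianPath_comap_of_cyclic_seq e v hrange hcard.symm hpos f hadj hclose hinj

/-- The Hamiltonian cycle in the union of two matchings `doubleReflGraph`. -/
def doubleReflSeq (i j : ZMod p) (k : ℕ) : ZMod p × Bool :=
  if k < p then (reflSeq i j k, false) else (reflSeq i j (2 * p - 1 - k), true)

theorem doubleReflSeq_injOn (hodd : Odd p) {i j : ZMod p} (hij : i ≠ j) :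
    Set.InjOn (doubleReflSeq i j) (Set.Iio (2 * p)) := by
  intro k hk l hl h
  rw [Set.mem_Iio] at hk hl
  unfold doubleReflSeq at h
  split_ifs at h with h1 h2 h2
  · exact reflSeq_injOn hodd hij h1 h2 (Prod.ext_iff.1 h).1
  · simp at h
  · simp at h
  · have := reflSeq_injOn hodd hij (Set.mem_Iio.2 (by omega)) (Set.mem_Iio.2 (by omega))
      (Prod.ext_iff.1 h).1
    omega

/-- The cycle follows the path from `i` to `j` in one copy, crosses at `j`, and runs back in the
other copy; the edge at `i` closes it. -/
theorem doubleReflSeq_adj (hodd : Odd p) {i j : ZMod p} (hij : i ≠ j) {k : ℕ}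
    (hk : k + 1 < 2 * p) :
    (doubleReflGraph i ⊔ doubleReflGraph j).Adj (doubleReflSeq i j k)
      (doubleReflSeq i j (k + 1)) := by
  have hlift : ∀ x y b, (reflGraph i ⊔ reflGraph j).Adj x y →
      (doubleReflGraph i ⊔ doubleReflGraph j).Adj (x, b) (y, b) := fun x y b h =>
    h.imp (fun h => Or.inl ⟨rfl, h⟩) fun h => Or.inl ⟨rfl, h⟩
  unfold doubleReflSeq
  by_cases h1 : k + 1 < p
  · rw [if_pos h1, if_pos (by omega)]
    exact hlift _ _ _ (reflSeq_adj hodd hij h1)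
  · rw [if_neg h1]
    by_cases h2 : k < p
    · have hk1 : k = p - 1 := by omega
      have hk2 : 2 * p - 1 - (k + 1) = p - 1 := by omega
      rw [if_pos h2, hk2, hk1, reflSeq_last hodd]
      exact Or.inr (Or.inr ⟨by simp, rfl, rfl⟩)
    · rw [if_neg h2]
      have hk2 : 2 * p - 1 - k = 2 * p - 1 - (k + 1) + 1 := by omega
      rw [hk2]
      exact hlift _ _ _ (reflSeq_adj hodd hij (by omega)).symm

theorem doubleReflSeq_adj_last (i j : ZMod p) :
    (doubleReflGraph i ⊔ doubleReflGraph j).Adj (doubleReflSeq i j (2 * p - 1))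
      (doubleReflSeq i j 0) := by
  have hp := (Fact.out : p.Prime).two_le
  unfold doubleReflSeq
  rw [if_neg (by omega), if_pos (by omega), Nat.sub_self, reflSeq_zero]
  exact Or.inl (Or.inr ⟨by simp, rfl, rfl⟩)

/-- The Hamiltonian cycle in the union of two matchings `shiftGraph`. -/
def shiftSeq (d e : ZMod p) (k : ℕ) : ZMod p × Bool :=
  if k % 2 = 0 then (((k / 2 : ℕ) : ℤ) * (d - e), false)
  else (((k / 2 : ℕ) : ℤ) * (d - e) + d, true)

/-- Going forward by `d` and back by `e` translates by `d - e`, which has order `p`. -/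
theorem shiftSeq_injOn {d e : ZMod p} (hde : d ≠ e) :
    Set.InjOn (shiftSeq d e) (Set.Iio (2 * p)) := by
  intro k hk l hl h
  rw [Set.mem_Iio] at hk hl
  have key : (((k / 2 : ℕ) : ℤ) : ZMod p) * (d - e) = (((l / 2 : ℕ) : ℤ) : ZMod p) * (d - e) →
      k / 2 = l / 2 := by
    intro h
    have hdvd := dvd_sub_of_intCast_mul_eq (sub_ne_zero.2 hde) h
    have := eq_of_dvd_of_abs_le_two_mul (by omega) hdvd (by rw [abs_le]; omega)
    omega
  unfold shiftSeq at h
  split_ifs at h with h1 h2 h2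
  · have := key (Prod.ext_iff.1 h).1
    omega
  · simp at h
  · simp at h
  · have := key (add_right_cancel (Prod.ext_iff.1 h).1)
    omega

theorem shiftSeq_adj (d e : ZMod p) (k : ℕ) :
    (shiftGraph d ⊔ shiftGraph e).Adj (shiftSeq d e k) (shiftSeq d e (k + 1)) := by
  unfold shiftSeq
  by_cases hk : k % 2 = 0
  · rw [if_pos hk, if_neg (by omega), show (k + 1) / 2 = k / 2 by omega]
    exact Or.inl (Or.inl ⟨rfl, rfl, rfl⟩)
  · rw [if_neg hk, if_pos (by omega), show (k + 1) / 2 = k / 2 + 1 by omega]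
    refine Or.inr (Or.inr ⟨rfl, rfl, ?_⟩)
    push_cast
    ring

theorem shiftSeq_adj_last (d e : ZMod p) :
    (shiftGraph d ⊔ shiftGraph e).Adj (shiftSeq d e (2 * p - 1)) (shiftSeq d e 0) := by
  have hp := (Fact.out : p.Prime).two_le
  unfold shiftSeq
  rw [if_neg (by omega), if_pos rfl, show (2 * p - 1) / 2 = p - 1 by omega]
  refine Or.inr (Or.inr ⟨rfl, rfl, ?_⟩)
  -- The last vertex is therefore `-(d - e) + d = e` in the second copy, the shift by `e` of the
  -- initial `0`.
  have hcast : (((p - 1 : ℕ) : ℤ) : ZMod p) = -1 := by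
    rw [Nat.cast_sub (by omega)]
    simp
  rw [hcast]
  simp

/-- The coefficients `0, 1, -1, -2, 2, 3, -3, -4, 4, …`. -/
def mixedCoeff (k : ℕ) : ℤ := if k % 4 < 2 then ((k + 1) / 2 : ℕ) else -((k + 1) / 2 : ℕ)

/-- The Hamiltonian cycle in the union of a `doubleReflGraph` and a `shiftGraph`. -/
def mixedSeq (i d : ZMod p) (k : ℕ) : ZMod p × Bool :=
  (i + mixedCoeff k * d, decide ((k + 1) / 2 % 2 = 1))

/-- Within one copy all coefficients have the same parity, so differences are even, which excludes
`±p`. A difference of `±2p` would need both `p` and `-p`, but absolute value `p` occurs only at `k =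
2 * p - 1`. -/
theorem mixedSeq_injOn (hodd : Odd p) (i : ZMod p) {d : ZMod p} (hd : d ≠ 0) :
    Set.InjOn (mixedSeq i d) (Set.Iio (2 * p)) := by
  intro k hk l hl h
  obtain ⟨r, hr⟩ := hodd
  rw [Set.mem_Iio] at hk hl
  obtain ⟨h1, h2⟩ := Prod.ext_iff.1 h
  simp only [mixedSeq, decide_eq_decide] at h2
  have hdvd := dvd_sub_of_intCast_mul_eq hd (add_left_cancel h1)
  have hx : |mixedCoeff k - mixedCoeff l| ≤ 2 * (p : ℤ) := by
    rw [abs_le]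
    unfold mixedCoeff
    split_ifs <;> omega
  have := eq_of_dvd_of_abs_le_two_mul (by omega) hdvd hx
  unfold mixedCoeff at this
  split_ifs at this <;> omega

/-- Steps from even `k` follow the shift and change copy; steps from odd `k` reflect in `i`,
negating the coefficient within a copy. -/
theorem mixedSeq_adj (hodd : Odd p) (i : ZMod p) {d : ZMod p} (hd : d ≠ 0) {k : ℕ}
    (hk : k + 1 < 2 * p) :
    (doubleReflGraph i ⊔ shiftGraph d).Adj (mixedSeq i d k) (mixedSeq i d (k + 1)) := by
  by_cases h2 : k % 2 = 0
  · right
    by_cases h4 : k % 4 = 0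
    · left
      have hc : mixedCoeff (k + 1) = mixedCoeff k + 1 := by
        unfold mixedCoeff
        split_ifs <;> omega
      refine ⟨decide_eq_false (by omega), decide_eq_true (by omega), ?_⟩
      simp only [mixedSeq, hc]
      push_cast
      ring
    · right
      have hc : mixedCoeff k = mixedCoeff (k + 1) + 1 := by
        unfold mixedCoeff
        split_ifs <;> omega
      refine ⟨decide_eq_true (by omega), decide_eq_false (by omega), ?_⟩
      simp only [mixedSeq, hc]
      push_cast
      ring
  · left
    left
    have hc : mixedCoeff (k + 1) = -mixedCoeff k := by
      unfold mixedCoeff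
      split_ifs <;> omega
    have hb : (mixedSeq i d k).2 = (mixedSeq i d (k + 1)).2 := by
      simp only [mixedSeq, decide_eq_decide]
      omega
    refine ⟨hb, fun h => ?_, ?_⟩
    · have := mixedSeq_injOn hodd i hd (Set.mem_Iio.2 (by omega)) (Set.mem_Iio.2 hk)
        (Prod.ext h hb)
      omega
    · simp only [mixedSeq, hc]
      push_cast
      ring

/-- The last coefficient is `p`, zero in `ZMod p`, so the cycle closes by the edge joining the two
copies of `i`. -/
theorem mixedSeq_adj_last (hodd : Odd p) (i d : ZMod p) :
    (doubleReflGraph i ⊔ shiftGraph d).Adj (mixedSeq i d (2 * p - 1)) (mixedSeq i d 0) := by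
  obtain ⟨r, hr⟩ := hodd
  have hc : mixedCoeff (2 * p - 1) = p := by
    unfold mixedCoeff
    rw [if_pos (by omega)]
    omega
  refine Or.inl (Or.inr ⟨?_, ?_, ?_⟩)
  · simp only [mixedSeq, ne_eq, decide_eq_decide]
    omega
  · simp [mixedSeq, hc]
  · simp [mixedSeq, mixedCoeff]

/-- The matchings `doubleReflGraph i` and `shiftGraph d`, `d ≠ 0`, of the complete graph on two
copies of `ZMod p`. -/
def doubleMatching : ZMod p ⊕ {d : ZMod p // d ≠ 0} → SimpleGraph (ZMod p × Bool)
  | .inl i => doubleReflGraph i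
  | .inr d => shiftGraph d.1

theorem disjoint_doubleMatching (hodd : Odd p) (a b : ZMod p ⊕ {d : ZMod p // d ≠ 0})
    (hab : a ≠ b) : Disjoint (doubleMatching a) (doubleMatching b) := by
  rcases a with i | d <;> rcases b with j | e
  · exact disjoint_doubleReflGraph hodd fun h => hab (by rw [h])
  · exact disjoint_doubleReflGraph_shiftGraph i e.2
  · exact (disjoint_doubleReflGraph_shiftGraph j d.2).symm
  · exact disjoint_shiftGraph fun h => hab (by rw [Subtype.ext h])

theorem hasHamiltonianPath_comap_doubleMatching_sup {U : Type*} [DecidableEq U] [Fintype U]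
    {e : U → ZMod p × Bool} {v : ZMod p × Bool} (hrange : ∀ w, w ≠ v → ∃ u, e u = w)
    (hcard : Fintype.card U + 1 = 2 * p) (hodd : Odd p)
    (a b : ZMod p ⊕ {d : ZMod p // d ≠ 0}) (hab : a ≠ b) :
    HasHamiltonianPath ((doubleMatching a ⊔ doubleMatching b).comap e) := by
  have hmixed : ∀ (i : ZMod p) (d : {d : ZMod p // d ≠ 0}),
      HasHamiltonianPath ((doubleReflGraph i ⊔ shiftGraph d.1).comap e) := fun i d =>
    hasHamiltonianPath_comap_of_cyclic_seq_two_mul hrange hcard (mixedSeq i d.1)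
      (fun _ hk => mixedSeq_adj hodd i d.2 hk) (mixedSeq_adj_last hodd i d.1)
      (mixedSeq_injOn hodd i d.2)
  rcases a with i | d <;> rcases b with j | d'
  · have hij : i ≠ j := fun h => hab (by rw [h])
    exact hasHamiltonianPath_comap_of_cyclic_seq_two_mul hrange hcard (doubleReflSeq i j)
      (fun _ hk => doubleReflSeq_adj hodd hij hk) (doubleReflSeq_adj_last i j)
      (doubleReflSeq_injOn hodd hij)
  · exact hmixed i d'
  · rw [sup_comm]
    exact hmixed j d
  · have hdd : d.1 ≠ d'.1 := fun h => hab (by rw [Subtype.ext h])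
    exact hasHamiltonianPath_comap_of_cyclic_seq_two_mul hrange hcard (shiftSeq d.1 d'.1)
      (fun k _ => shiftSeq_adj d.1 d'.1 k) (shiftSeq_adj_last d.1 d'.1) (shiftSeq_injOn hdd)

end Odd

/-! ### Exact values of the maximum and the main theorem. -/

theorem maxGoodSize_hasHamiltonianPath_prime {p : ℕ} (hp : p.Prime) (hodd : Odd p) :
    maxGoodSize (HasHamiltonianPath (V := Fin p)) = 2 ^ (p - 1) := by
  have : Fact p.Prime := ⟨hp⟩
  let e : Fin p ≃ ZMod p := Fintype.equivOfCardEq (by simp [ZMod.card])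
  have := maxGoodSize_eq_of_disjoint (V := Fin p) (F := fun i : ZMod p => (reflGraph i).comap e)
    (by simp [ZMod.card]) (fun i j hij => disjoint_comap _ (disjoint_reflGraph hodd hij))
    (fun i j hij => (hasHamiltonianPath_reflGraph_sup hodd hij).map_equiv e)
  simpa using this

theorem maxGoodSize_hasHamiltonianPath_two_mul_prime_sub_one {p : ℕ} (hp : p.Prime)
    (hodd : Odd p) :
    maxGoodSize (HasHamiltonianPath (V := Fin (2 * p - 1))) = 2 ^ (2 * p - 2) := by
  have : Fact p.Prime := ⟨hp⟩
  have hp2 := hp.two_le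
  let v : ZMod p × Bool := (0, false)
  let φ : Fin (2 * p - 1) ≃ {w // w ≠ v} := Fintype.equivOfCardEq (by
    rw [Fintype.card_subtype_compl, card_zmod_prod_bool]
    simp)
  have hrange : ∀ w, w ≠ v → ∃ u, (φ u : ZMod p × Bool) = w := fun w hw =>
    ⟨φ.symm ⟨w, hw⟩, by simp⟩
  -- The count of matchings, `p + (p - 1)`, equals the number of vertices left after deleting `v`.
  have hcard : Fintype.card (ZMod p ⊕ {d : ZMod p // d ≠ 0}) =
      Fintype.card (Fin (2 * p - 1)) := by
    rw [Fintype.card_sum, Fintype.card_subtype_compl, ZMod.card]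
    simp
    omega
  have := maxGoodSize_eq_of_disjoint (V := Fin (2 * p - 1))
    (F := fun a => (doubleMatching (p := p) a).comap fun u => (φ u : ZMod p × Bool)) hcard
    (fun a b hab => disjoint_comap _ (disjoint_doubleMatching hodd a b hab))
    (fun a b hab => hasHamiltonianPath_comap_doubleMatching_sup hrange
      (by rw [Fintype.card_fin]; omega) hodd a b hab)
  simpa [Nat.sub_sub] using this

theorem mainTheorem7 :
    (∀ n : ℕ, 1 ≤ n → ∀ ℳ : Set (⊤ : SimpleGraph (Fin (n + 1))).Subgraph,
      IsPerfectOneFactorization (⊤ : SimpleGraph (Fin (n + 1))) ℳ →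
        maxGoodSize (HasHamiltonianPath (V := Fin n)) = 2 ^ (n - 1) ∧
        ∀ v : Fin (n + 1),
          IsGoodFamily HasHamiltonianPath (evenUnionsDeleting ℳ v) ∧
          (evenUnionsDeleting ℳ v).ncard = 2 ^ (n - 1)) ∧
    (∀ p : ℕ, p.Prime → Odd p →
      maxGoodSize (HasHamiltonianPath (V := Fin p)) = 2 ^ (p - 1) ∧
      maxGoodSize (HasHamiltonianPath (V := Fin (2 * p - 1))) = 2 ^ (2 * p - 2)) ∧
    {n : ℕ | 1 ≤ n ∧ maxGoodSize (HasHamiltonianPath (V := Fin n)) = 2 ^ (n - 1)}.Infinite := by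
  refine ⟨fun n hn ℳ hℳ => ⟨?_, hℳ.isGoodFamily_and_ncard hn⟩, fun p hp hodd =>
    ⟨maxGoodSize_hasHamiltonianPath_prime hp hodd,
      maxGoodSize_hasHamiltonianPath_two_mul_prime_sub_one hp hodd⟩, ?_⟩
  · have : Nonempty (Fin n) := ⟨⟨0, hn⟩⟩
    have := maxGoodSize_eq_of_exists (V := Fin n)
      ⟨evenUnionsDeleting ℳ 0, by simpa using hℳ.isGoodFamily_and_ncard hn 0⟩
    simpa using this
  · refine (Nat.infinite_setOfPred_prime.sdiff (Set.finite_singleton 2)).mono ?_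
    rintro p ⟨hp, hp2⟩
    exact ⟨hp.one_le, maxGoodSize_hasHamiltonianPath_prime hp (hp.odd_of_ne_two hp2)⟩
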